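/- Let $\Omega\subseteq\mathbb{C}$ be open, $X$ a complex Banach space with dual $X'$, and $H$ a complex Hilbert space with dual $H'$. **Spaces of operators.** For a bounded linear $T:H\to X$ let $\|T\|_\gamma=\sup\big(\mathbb{E}\|\sum_{j}\gamma_jTe_j\|^2\big)^{1/2}$, the supremum being taken over all finite orthonormal systems $(e_j)$ in $H$, where the $\gamma_j$ are independent complex standard Gaussians (that is, $\gamma_j=\gamma_j^r+i\gamma_j^i$ with independent real standard Gaussians $\gamma_j^r,\gamma_j^i$). Let $\gamma(H;X)$ be the $\|\cdot\|_\gamma$-closure of the finite rank operators in $\{T:\|T\|_\gamma<\infty\}$. Let $\gamma'(H';X')$ be the space of bounded linear $V:H'\to X'$ with $\|V\|_{\gamma'}=\sup\{|\mathrm{tr}(V'U)| : U:H\to X \text{ of finite rank},\ \|U\|_\gamma\le1\}<\infty$. For $U\in\gamma(H;X)$ and $V\in\gamma'(H';X')$ put $\langle U,V\rangle=\mathrm{tr}(V'U)=\sum_\alpha\langle Ue_\alpha,V\overline{e_\alpha}\rangle$, where $(e_\alpha)$ is any orthonormal basis of $H$ and $\overline{e_\alpha}=(\,\cdot\,|\,e_\alpha)\in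 H'$ (the series converges unconditionally, with a sum independent of the basis). **Functional calculus.** Let $\mathcal{E}$ be a subalgebra of $H^\infty(\Omega)$, the algebra of bounded holomorphic functions on $\Omega$, and $\Phi:\mathcal{E}\to\mathcal{L}(X)$ an algebra homomorphism. Assume that there is $e\in\mathcal{E}$ such that 1. $ef\in\mathcal{E}$ for all $f\in H^\infty(\Omega)$; 2. if $(f_n)$ is a sequence in $H^\infty(\Omega)$ with $\sup_n\|f_n\|_\infty<\infty$ and $f_n\to f\in H^\infty(\Omega)$ pointwise, then $\Phi(ef_n)\to\Phi(ef)$ in the weak operator topology; 3. $\Phi(e)$ is injective. For $f\in H^\infty(\Omega)$ let $\Phi(f)=\Phi(e)^{-1}\Phi(ef)$ with its natural domain (this does not depend on the choice of $e\in\mathcal E$ with $ef\in\mathcal{E}$ and $\Phi(e)$ injective). **Square functions.** Let $g:\Omega\to H'$ with $\langle h,g(\cdot)\rangle\in H^\infty(\Omega)$ for all $h\in H$ (written $g\in H^\infty(\Omega;H')$). The operator $\Phi_\gamma(g):\mathrm{dom}(\Phi_\gamma(g))\subseteq X\to\gamma(H;X)$ is defined by $[\Phi_\gamma(g)x]h=\Phi(\langle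 h,g\rangle)x$, its domain being the set of all $x\in\bigcap_{h\in H}\mathrm{dom}(\Phi(\langle h,g\rangle))$ for which $h\mapsto\Phi(\langle h,g\rangle)x$ belongs to $\gamma(H;X)$. Let $f:\Omega\to H$ with $\langle f(\cdot),h'\rangle\in H^\infty(\Omega)$ for all $h'\in H'$ (written $f\in H^\infty(\Omega;H)$), and assume that $\Phi(\langle f,h'\rangle)$ is densely defined for every $h'\in H'$. The operator $\Phi_{\gamma'}(f):\mathrm{dom}(\Phi_{\gamma'}(f))\subseteq X'\to\gamma'(H';X')$ is defined by $[\Phi_{\gamma'}(f)x']h'=\Phi(\langle f,h'\rangle)'x'$, its domain being the set of all $x'\in\bigcap_{h'\in H'}\mathrm{dom}(\Phi(\langle f,h'\rangle)')$ for which $h'\mapsto\Phi(\langle f,h'\rangle)'x'$ belongs to $\gamma'(H';X')$. Call such an operator *bounded* if it is defined on all of $X$ (respectively $X'$) and satisfies a norm estimate $\|\Phi_\gamma(g)x\|_\gamma\le K\|x\|$ (respectively $\|\Phi_{\gamma'}(f)x'\|_{\gamma'}\le K\|x'\|$). Let $\langle f,g\rangle(z)=\langle f(z),g(z)\rangle$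 for $z\in\Omega$. **Theorem.** Let $f\in H^\infty(\Omega;H)$ and $g\in H^\infty(\Omega;H')$ be as above, and suppose that $\Phi_{\gamma'}(f)$ is bounded. Then $$\Phi_{\gamma'}(f)'\,\Phi_\gamma(g)\subseteq\Phi(\langle f,g\rangle),$$ where, for $U\in\gamma(H;X)$ and $y\in X$, $\Phi_{\gamma'}(f)'U=y$ means that $\langle y,x'\rangle=\langle U,\Phi_{\gamma'}(f)x'\rangle$ for all $x'\in X'$. Moreover $\mathrm{dom}(\Phi_\gamma(g))\subseteq\mathrm{dom}(\Phi(\langle f,g\rangle))$ and $$\langle\Phi(\langle f,g\rangle)x,x'\rangle=\langle\Phi_\gamma(g)x,\Phi_{\gamma'}(f)x'\rangle\qquad(x\in\mathrm{dom}(\Phi_\gamma(g)),\ x'\in X').$$ In particular, if $K\ge0$ satisfies $\|\Phi_{\gamma'}(f)x'\|_{\gamma'}\le K\|x'\|$ for all $x'\in X'$, then $\|\Phi(\langle f,g\rangle)x\|\le K\,\|\Phi_\gamma(g)x\|_\gamma$ for all $x\in\mathrm{dom}(\Phi_\gamma(g))$. **Corollary.** If in addition $\Phi_\gamma(g)$ is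 bounded, then $\Phi(\langle f,g\rangle)$ is a bounded operator defined on all of $X$, and the duality formula holds for all $x\in X$ and $x'\in X'$. If moreover $\langle f,g\rangle=1$ on $\Omega$, then there are constants $c,K>0$ with $c\|x\|\le\|\Phi_\gamma(g)x\|_\gamma\le K\|x\|$ for all $x\in X$. -/

import Mathlib

set_option maxSynthPendingDepth 3

open MeasureTheory ProbabilityTheory Filter Topology
open scoped ENNReal NNReal

noncomputable section

namespace SquareFn

/-! ## Gamma-radonifying operators -/

section Gamma

variable {H X : Type*} [NormedAddCommGroup H] [InnerProductSpace ℂ H]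
  [NormedAddCommGroup X] [NormedSpace ℂ X]

/-- The law of `n` independent pairs of independent real standard Gaussians. -/
def gaussPairs (n : ℕ) : Measure (Fin n → ℝ × ℝ) :=
  Measure.pi fun _ => (gaussianReal 0 1).prod (gaussianReal 0 1)

/-- The `j`-th of `n` independent complex standard Gaussians `γ_r + i γ_i` (with `γ_r`, `γ_i`
independent real standard Gaussians), as a random variable on the space of `gaussPairs n`. -/
def cGauss {n : ℕ} (j : Fin n) (w : Fin n → ℝ × ℝ) : ℂ :=
  ((w j).1 : ℂ) + ((w j).2 : ℂ) * Complex.I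

/-- `(E ‖∑ j, γ_j x_j‖²)^(1/2)` for independent complex standard Gaussians `γ_j`. -/
def gaussL2 {n : ℕ} (x : Fin n → X) : ℝ≥0∞ :=
  (∫⁻ w, ‖∑ j, cGauss j w • x j‖ₑ ^ (2 : ℝ) ∂gaussPairs n) ^ (1 / 2 : ℝ)

/-- The `γ`-norm: the supremum of `(E ‖∑ j, γ_j T e_j‖²)^(1/2)` over all finite orthonormal
systems `(e_j)` in `H`; it is `∞` iff `T` is not `γ`-summing. -/
def gammaNorm (T : H →L[ℂ] X) : ℝ≥0∞ :=
  ⨆ (n : ℕ) (e : Fin n → H) (_ : Orthonormal ℂ e), gaussL2 fun j => T (e j)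

theorem gaussL2_add_le {n : ℕ} (x y : Fin n → X) :
    gaussL2 (x + y) ≤ gaussL2 x + gaussL2 y := by
  have hm : ∀ z : Fin n → X,
      AEMeasurable (fun w => ‖∑ j, cGauss j w • z j‖ₑ) (gaussPairs n) := fun z => by
    refine (Continuous.measurable ?_).aemeasurable
    unfold cGauss
    fun_prop
  refine le_trans ?_ (ENNReal.lintegral_Lp_add_le (hm x) (hm y) (by norm_num : (1 : ℝ) ≤ 2))
  refine ENNReal.rpow_le_rpow (lintegral_mono fun w => ?_) (by norm_num)
  refine ENNReal.rpow_le_rpow ?_ (by norm_num)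
  simp only [Pi.add_apply, smul_add, Finset.sum_add_distrib]
  exact enorm_add_le _ _

theorem gaussL2_smul_le {n : ℕ} (c : ℂ) (x : Fin n → X) :
    gaussL2 (c • x) ≤ ‖c‖ₑ * gaussL2 x := by
  unfold gaussL2
  have h : ∀ w : Fin n → ℝ × ℝ, ‖∑ j, cGauss j w • (c • x) j‖ₑ ^ (2 : ℝ)
      = ‖c‖ₑ ^ (2 : ℝ) * ‖∑ j, cGauss j w • x j‖ₑ ^ (2 : ℝ) := fun w => by
    rw [← ENNReal.mul_rpow_of_nonneg _ _ (by norm_num), ← enorm_smul, Finset.smul_sum]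
    simp only [Pi.smul_apply, smul_comm c]
  simp only [h]
  rw [lintegral_const_mul' _ _ (by simp), ENNReal.mul_rpow_of_nonneg _ _ (by norm_num),
    ← ENNReal.rpow_mul]
  norm_num

theorem gammaNorm_add_le (S T : H →L[ℂ] X) :
    gammaNorm (S + T) ≤ gammaNorm S + gammaNorm T := by
  refine iSup_le fun n => iSup_le fun e => iSup_le fun he => ?_
  refine (gaussL2_add_le (fun j => S (e j)) (fun j => T (e j))).trans ?_
  refine add_le_add ?_ ?_
  · exact le_iSup_of_le n (le_iSup_of_le e (le_iSup_of_le he le_rfl))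
  · exact le_iSup_of_le n (le_iSup_of_le e (le_iSup_of_le he le_rfl))

theorem gammaNorm_smul_le (c : ℂ) (T : H →L[ℂ] X) :
    gammaNorm (c • T) ≤ ‖c‖ₑ * gammaNorm T := by
  refine iSup_le fun n => iSup_le fun e => iSup_le fun he => ?_
  refine (gaussL2_smul_le c (fun j => T (e j))).trans ?_
  gcongr
  exact le_iSup_of_le n (le_iSup_of_le e (le_iSup_of_le he le_rfl))

theorem gammaNorm_zero : gammaNorm (0 : H →L[ℂ] X) = 0 := by
  simpa using gammaNorm_smul_le (0 : ℂ) (0 : H →L[ℂ] X)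

/-- `T` has finite rank. -/
def IsFiniteRank (T : H →L[ℂ] X) : Prop :=
  FiniteDimensional ℂ (LinearMap.range (T : H →ₗ[ℂ] X))

variable (H X) in
/-- The space `γ(H;X)` of `γ`-radonifying operators: the closure, with respect to the `γ`-norm,
of the finite rank operators in the space of `γ`-summing operators. -/
def gammaRad : Submodule ℂ (H →L[ℂ] X) where
  carrier := {T | gammaNorm T < ∞ ∧
    ∀ ε : ℝ≥0∞, 0 < ε → ∃ S : H →L[ℂ] X, IsFiniteRank S ∧ gammaNorm (T - S) < ε}
  zero_mem' := by
    refine ⟨by simp [gammaNorm_zero], fun ε hε => ⟨0, ?_, by simpa [gammaNorm_zero] using hε⟩⟩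
    have h0 : LinearMap.range ((0 : H →L[ℂ] X) : H →ₗ[ℂ] X) = ⊥ := LinearMap.range_zero
    rw [IsFiniteRank, h0]
    infer_instance
  add_mem' := by
    rintro S T ⟨hS, hS'⟩ ⟨hT, hT'⟩
    refine ⟨(gammaNorm_add_le S T).trans_lt (ENNReal.add_lt_top.2 ⟨hS, hT⟩), fun ε hε => ?_⟩
    obtain ⟨S₀, hr, hs⟩ := hS' (ε / 2) (ENNReal.half_pos hε.ne')
    obtain ⟨T₀, hr', ht⟩ := hT' (ε / 2) (ENNReal.half_pos hε.ne')
    refine ⟨S₀ + T₀, ?_, ?_⟩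
    · unfold IsFiniteRank at *
      exact Submodule.finiteDimensional_of_le
        (LinearMap.range_add_le (S₀ : H →ₗ[ℂ] X) (T₀ : H →ₗ[ℂ] X))
    · rw [add_sub_add_comm]
      refine (gammaNorm_add_le _ _).trans_lt ?_
      rw [← ENNReal.add_halves ε]
      exact ENNReal.add_lt_add hs ht
  smul_mem' := by
    rintro c T ⟨hT, hT'⟩
    refine ⟨(gammaNorm_smul_le c T).trans_lt (ENNReal.mul_lt_top (by simp) hT), fun ε hε => ?_⟩
    obtain ⟨S, hr, hs⟩ := hT' (ε / (‖c‖ₑ + 1)) (ENNReal.div_pos hε.ne' (by simp))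
    refine ⟨c • S, ?_, ?_⟩
    · unfold IsFiniteRank at *
      refine Submodule.finiteDimensional_of_le
        (S₂ := LinearMap.range (S : H →ₗ[ℂ] X)) ?_
      rintro _ ⟨h, rfl⟩
      exact Submodule.smul_mem _ c ⟨h, rfl⟩
    · rw [← smul_sub]
      refine (gammaNorm_smul_le _ _).trans_lt ?_
      have h1 : ‖c‖ₑ * gammaNorm (T - S) ≤ (‖c‖ₑ + 1) * gammaNorm (T - S) := by
        gcongr
        exact le_self_add
      refine h1.trans_lt ?_
      rw [mul_comm]
      exact (ENNReal.lt_div_iff_mul_lt (by simp) (by simp)).1 hs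

/-! ### The dual space under trace duality -/

/-- The `γ'`-norm of `V : H' → X'`: the supremum of `|tr (V'U)|` over all finite rank operators
`U : H → X` with `‖U‖_γ ≤ 1`. The finite rank operators are the `U = ∑ j, g_j ⊗ x_j` with
`g_j ∈ H'`, `x_j ∈ X`, and then `tr (V'U) = ∑ j, ⟨x_j, V g_j⟩`. -/
def gammaDualNorm (V : StrongDual ℂ H →L[ℂ] StrongDual ℂ X) : ℝ≥0∞ :=
  ⨆ (n : ℕ) (g : Fin n → StrongDual ℂ H) (x : Fin n → X)
    (_ : gammaNorm (∑ j, (g j).smulRight (x j)) ≤ 1), ‖∑ j, V (g j) (x j)‖ₑ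

theorem gammaDualNorm_add_le (V W : StrongDual ℂ H →L[ℂ] StrongDual ℂ X) :
    gammaDualNorm (V + W) ≤ gammaDualNorm V + gammaDualNorm W := by
  refine iSup_le fun n => iSup_le fun g => iSup_le fun x => iSup_le fun h => ?_
  simp only [add_apply, Finset.sum_add_distrib]
  refine (enorm_add_le _ _).trans (add_le_add ?_ ?_)
  · exact le_iSup_of_le n (le_iSup_of_le g (le_iSup_of_le x (le_iSup_of_le h le_rfl)))
  · exact le_iSup_of_le n (le_iSup_of_le g (le_iSup_of_le x (le_iSup_of_le h le_rfl)))

theorem gammaDualNorm_smul_le (c : ℂ) (V : StrongDual ℂ H →L[ℂ] StrongDual ℂ X) :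
    gammaDualNorm (c • V) ≤ ‖c‖ₑ * gammaDualNorm V := by
  refine iSup_le fun n => iSup_le fun g => iSup_le fun x => iSup_le fun h => ?_
  simp only [smul_apply, ← Finset.smul_sum, enorm_smul]
  gcongr
  exact le_iSup_of_le n (le_iSup_of_le g (le_iSup_of_le x (le_iSup_of_le h le_rfl)))

variable (H X) in
/-- The space `γ'(H';X')` of all `V : H' → X'` with finite `γ'`-norm. -/
def gammaDual : Submodule ℂ (StrongDual ℂ H →L[ℂ] StrongDual ℂ X) where
  carrier := {V | gammaDualNorm V < ∞}
  zero_mem' := by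
    simp [gammaDualNorm]
  add_mem' := fun {V W} hV hW =>
    (gammaDualNorm_add_le V W).trans_lt (ENNReal.add_lt_top.2 ⟨hV, hW⟩)
  smul_mem' := fun c V hV =>
    (gammaDualNorm_smul_le c V).trans_lt (ENNReal.mul_lt_top (by simp) hV)

end Gamma

universe u v

section Trace

variable {H : Type u} [NormedAddCommGroup H] [InnerProductSpace ℂ H]
  {X : Type v} [NormedAddCommGroup X] [NormedSpace ℂ X]

/-- Trace duality between `γ(H;X)` and `γ'(H';X')`: the statement `⟨U, V⟩ = tr (V'U) = t`.
The trace of `V'U` is its sum of diagonal entries `⟨U b_i, V (conj b_i)⟩`, where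
`conj b_i = (· | b_i) ∈ H'`; the series has to converge unconditionally to `t` for every
orthonormal basis `b` of `H`. -/
def HasTraceDuality (U : gammaRad H X) (V : gammaDual H X) (t : ℂ) : Prop :=
  ∀ (ι : Type u) (b : HilbertBasis ι ℂ H),
    HasSum (fun i => V.1 (innerSL ℂ (b i)) (U.1 (b i))) t

/-- The graph of the part in `γ(H;X) × X` of the adjoint `B' : γ'(H';X')' → X''` of an operator
`B : X' → γ'(H';X')`, where `γ(H;X)` embeds into `γ'(H';X')'` by trace duality and `X` embeds
into `X''` canonically: `y = B'U` iff `⟨y, x'⟩ = ⟨U, B x'⟩` for all `x'` in the domain. -/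
def traceAdjointGraph (B : StrongDual ℂ X →ₗ.[ℂ] gammaDual H X) : Set (gammaRad H X × X) :=
  {p | ∀ x' : B.domain, HasTraceDuality p.1 (B x') (x'.1 p.2)}

end Trace

/-! ## Functional calculus -/

/-- An abstract functional calculus `(E, F, Φ)` on `X`: `F` is a unital algebra of scalar functions
on `S`, `E` a (not necessarily unital) subalgebra of `F`, and `Φ : E → L(X)` an algebra
homomorphism. -/
structure FunctionalCalculus {S : Type*} (F : Subalgebra ℂ (S → ℂ)) (X : Type*)
    [NormedAddCommGroup X] [NormedSpace ℂ X] where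
  /-- the algebra of elementary functions -/
  E : NonUnitalSubalgebra ℂ (S → ℂ)
  E_le : ∀ f ∈ E, f ∈ F
  /-- the elementary calculus -/
  Φ : E →ₙₐ[ℂ] (X →L[ℂ] X)

/-- The graph of the adjoint `A'` of an operator `A` on `X`. -/
def adjointGraph {X : Type*} [NormedAddCommGroup X] [NormedSpace ℂ X] (A : X →ₗ.[ℂ] X) :
    Submodule ℂ (StrongDual ℂ X × StrongDual ℂ X) where
  carrier := {p | ∀ x : A.domain, p.1 (A x) = p.2 x}
  zero_mem' := fun x => by simp
  add_mem' := fun {p q} hp hq x => by simp [hp x, hq x]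
  smul_mem' := fun c p hp x => by simp [hp x]

/-- The adjoint `A'` of a densely defined operator `A` on `X`. -/
def adjointOp {X : Type*} [NormedAddCommGroup X] [NormedSpace ℂ X] (A : X →ₗ.[ℂ] X) :
    StrongDual ℂ X →ₗ.[ℂ] StrongDual ℂ X :=
  (adjointGraph A).toLinearPMap

section Functions

variable {S H : Type*} [NormedAddCommGroup H] [InnerProductSpace ℂ H]

/-- `F(S;H')`: the functions `g : S → H'` with `z ↦ ⟨h, g z⟩` in `F` for all `h ∈ H`. -/
def MemDualValued (F : Subalgebra ℂ (S → ℂ)) (g : S → StrongDual ℂ H) : Prop :=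
  ∀ h : H, (fun z => g z h) ∈ F

/-- `F(S;H)`: the functions `f : S → H` with `z ↦ ⟨f z, h'⟩` in `F` for all `h' ∈ H'`. -/
def MemValued (F : Subalgebra ℂ (S → ℂ)) (f : S → H) : Prop :=
  ∀ h' : StrongDual ℂ H, (fun z => h' (f z)) ∈ F

/-- The scalar function `⟨f, g⟩ : z ↦ ⟨f z, g z⟩_{H,H'}`. -/
def pairing (f : S → H) (g : S → StrongDual ℂ H) : S → ℂ := fun z => g z (f z)

end Functions

/-- The algebra `H^∞(Ω)` of bounded holomorphic functions on an (open) set `Ω ⊆ ℂ`. -/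
def HInfty (Ω : Set ℂ) : Subalgebra ℂ (Ω → ℂ) where
  carrier := {f | (∃ F : ℂ → ℂ, DifferentiableOn ℂ F Ω ∧ ∀ z : Ω, F z = f z) ∧
    ∃ K : ℝ, ∀ z, ‖f z‖ ≤ K}
  add_mem' := by
    rintro f g ⟨⟨F, hF, hf⟩, K, hK⟩ ⟨⟨G, hG, hg⟩, L, hL⟩
    exact ⟨⟨F + G, hF.add hG, fun z => by simp [hf, hg]⟩, K + L, fun z =>
      (norm_add_le _ _).trans (add_le_add (hK z) (hL z))⟩
  mul_mem' := by
    rintro f g ⟨⟨F, hF, hf⟩, K, hK⟩ ⟨⟨G, hG, hg⟩, L, hL⟩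
    refine ⟨⟨F * G, hF.mul hG, fun z => by simp [hf, hg]⟩, K * L, fun z => ?_⟩
    rw [Pi.mul_apply, norm_mul]
    exact mul_le_mul (hK z) (hL z) (norm_nonneg _) ((norm_nonneg _).trans (hK z))
  algebraMap_mem' := fun c =>
    ⟨⟨fun _ => c, differentiableOn_const c, fun z => rfl⟩, ‖c‖, fun z => le_rfl⟩

namespace FunctionalCalculus

variable {S : Type*} {F : Subalgebra ℂ (S → ℂ)} {X : Type*} [NormedAddCommGroup X]
  [NormedSpace ℂ X] (C : FunctionalCalculus F X)

/-- `e ∈ E` is a regulariser of `f`: `e f ∈ E` and `Φ(e)` is injective. -/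
def IsRegulariser (e : C.E) (f : S → ℂ) : Prop :=
  (e : S → ℂ) * f ∈ C.E ∧ Function.Injective (C.Φ e)

/-- The graph of `Φ(f) = Φ(e)⁻¹ Φ(e f)`: the pairs `(x, y)` with `Φ(e) y = Φ(e f) x`, for any
regulariser `e` of `f` (the choice does not matter, see `mem_graph_Phi_iff`). -/
def graphPhi (f : S → ℂ) : Submodule ℂ (X × X) where
  carrier := {p | ∀ (e : C.E) (he : C.IsRegulariser e f),
    C.Φ e p.2 = C.Φ ⟨(e : S → ℂ) * f, he.1⟩ p.1}
  zero_mem' := fun e he => by simp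
  add_mem' := fun {p q} hp hq e he => by simp [hp e he, hq e he]
  smul_mem' := fun c p hp e he => by simp [hp e he]

/-- The operator `Φ(f)`, for a regularisable function `f`, with its natural domain. -/
def Phi (f : S → ℂ) : X →ₗ.[ℂ] X := (C.graphPhi f).toLinearPMap

theorem mem_graph_Phi_iff {f : S → ℂ} {e : C.E} (he : C.IsRegulariser e f) (x y : X) :
    (x, y) ∈ (C.Phi f).graph ↔ C.Φ e y = C.Φ ⟨(e : S → ℂ) * f, he.1⟩ x := by
  have hfun : ∀ p ∈ C.graphPhi f, p.1 = 0 → p.2 = 0 := fun p hp h0 => by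
    have := hp e he
    rw [h0, map_zero] at this
    exact he.2 (this.trans (map_zero _).symm)
  rw [Phi, Submodule.toLinearPMap_graph_eq _ hfun]
  refine ⟨fun h => h e he, fun h d hd => ?_⟩
  refine he.2 ?_
  have h1 : C.Φ e (C.Φ d y) = C.Φ d (C.Φ e y) := by
    rw [← mul_apply_eq_comp, ← mul_apply_eq_comp, ← map_mul, ← map_mul]
    congr 2
    exact Subtype.ext (mul_comm _ _)
  have h2 : C.Φ e (C.Φ ⟨(d : S → ℂ) * f, hd.1⟩ x) = C.Φ d (C.Φ ⟨(e : S → ℂ) * f, he.1⟩ x) := by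
    rw [← mul_apply_eq_comp, ← mul_apply_eq_comp, ← map_mul, ← map_mul]
    congr 2
    exact Subtype.ext (mul_left_comm _ _ _)
  change C.Φ e (C.Φ d y) = C.Φ e (C.Φ ⟨(d : S → ℂ) * f, hd.1⟩ x)
  rw [h1, h2, h]

variable {H : Type*} [NormedAddCommGroup H] [InnerProductSpace ℂ H]

/-- The graph of `Φ(g)`, for `g` with values in `H'`: the pairs `(x, T)` with `T : H → X` such that
`x` is in the domain of `Φ(⟨h, g⟩)` and `T h = Φ(⟨h, g⟩) x`, for all `h ∈ H`. -/
def graphVec (g : S → StrongDual ℂ H) : Submodule ℂ (X × (H →L[ℂ] X)) where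
  carrier := {p | ∀ h : H, (p.1, p.2 h) ∈ (C.Phi fun z => g z h).graph}
  zero_mem' := fun _ => Submodule.zero_mem _
  add_mem' := fun hp hq h => Submodule.add_mem _ (hp h) (hq h)
  smul_mem' := fun c _ hp h => Submodule.smul_mem _ c (hp h)

/-- The square function `Φ_γ(g) : dom(Φ_γ(g)) → γ(H;X)`: the part of `Φ(g)` in `γ(H;X)`. -/
def PhiGamma (g : S → StrongDual ℂ H) : X →ₗ.[ℂ] gammaRad H X :=
  ((C.graphVec g).comap
    (LinearMap.prodMap LinearMap.id (gammaRad H X).subtype)).toLinearPMap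

/-- The graph of `Φ^d(f)`, for `f` with values in `H`: the pairs `(x', V)` with `V : H' → X'` such
that `x'` is in the domain of `Φ(⟨f, h'⟩)'` and `V h' = Φ(⟨f, h'⟩)' x'`, for all `h' ∈ H'`. -/
def graphVecDual (f : S → H) :
    Submodule ℂ (StrongDual ℂ X × (StrongDual ℂ H →L[ℂ] StrongDual ℂ X)) where
  carrier := {p | ∀ h' : StrongDual ℂ H,
    (p.1, p.2 h') ∈ (adjointOp (C.Phi fun z => h' (f z))).graph}
  zero_mem' := fun _ => Submodule.zero_mem _
  add_mem' := fun hp hq h => Submodule.add_mem _ (hp h) (hq h)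
  smul_mem' := fun c _ hp h => Submodule.smul_mem _ c (hp h)

/-- The dual square function `Φ_γ'(f) : dom(Φ_γ'(f)) → γ'(H';X')`: the part of `Φ^d(f)` in
`γ'(H';X')`. -/
def PhiGammaDual (f : S → H) : StrongDual ℂ X →ₗ.[ℂ] gammaDual H X :=
  ((C.graphVecDual f).comap
    (LinearMap.prodMap LinearMap.id (gammaDual H X).subtype)).toLinearPMap

/-- The standing assumption under which dual square functions are considered: `Φ(⟨f, h'⟩)` is
densely defined for all `h' ∈ H'`, so that its adjoint is single-valued. -/
def DualWellDefined (f : S → H) : Prop :=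
  ∀ h' : StrongDual ℂ H, Dense ((C.Phi fun z => h' (f z)).domain : Set X)

/-- `Φ_γ(g)` is bounded with bound `K`: it is defined on all of `X` and
`‖Φ_γ(g) x‖_γ ≤ K ‖x‖`. -/
def PhiGammaBound (g : S → StrongDual ℂ H) (K : ℝ≥0) : Prop :=
  (C.PhiGamma g).domain = ⊤ ∧
    ∀ x : (C.PhiGamma g).domain, gammaNorm (C.PhiGamma g x).1 ≤ K * ‖(x : X)‖ₑ

/-- `Φ_γ'(f)` is bounded with bound `K`: it is defined on all of `X'` and
`‖Φ_γ'(f) x'‖_γ' ≤ K ‖x'‖`. -/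
def PhiGammaDualBound (f : S → H) (K : ℝ≥0) : Prop :=
  (C.PhiGammaDual f).domain = ⊤ ∧
    ∀ x' : (C.PhiGammaDual f).domain,
      gammaDualNorm (C.PhiGammaDual f x').1 ≤ K * ‖(x' : StrongDual ℂ X)‖ₑ

end FunctionalCalculus

/-- The requirements on `e` for a calculus `(E, H^∞(Ω), Φ)`: `e` multiplies `H^∞(Ω)` into `E`,
`f ↦ Φ(e f)` turns bounded pointwise convergence of sequences into weak operator convergence, and
`Φ(e)` is injective. -/
structure IsUniversalRegulariser {Ω : Set ℂ} {X : Type*} [NormedAddCommGroup X] [NormedSpace ℂ X]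
    (C : FunctionalCalculus (HInfty Ω) X) (e : C.E) : Prop where
  mul_mem : ∀ f ∈ HInfty Ω, (e : Ω → ℂ) * f ∈ C.E
  weak_conv : ∀ (f : ℕ → Ω → ℂ) (f₀ : Ω → ℂ) (hf : ∀ n, f n ∈ HInfty Ω) (hf₀ : f₀ ∈ HInfty Ω),
    (∃ K : ℝ, ∀ n z, ‖f n z‖ ≤ K) → (∀ z, Tendsto (fun n => f n z) atTop (𝓝 (f₀ z))) →
    ∀ (x : X) (x' : StrongDual ℂ X),
      Tendsto (fun n => x' (C.Φ ⟨(e : Ω → ℂ) * f n, mul_mem _ (hf n)⟩ x)) atTop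
        (𝓝 (x' (C.Φ ⟨(e : Ω → ℂ) * f₀, mul_mem _ hf₀⟩ x)))
  injective : Function.Injective (C.Φ e)

end SquareFn

end

/-!
Expanding in an orthonormal basis `(b i)` of `H` gives `⟨f, g⟩ = ∑ i, ⟨f, conj (b i)⟩ ⟨b i, g⟩`
pointwise on `Ω`, with uniformly bounded partial sums. Multiplying the partial sums by `e` and using
the weak continuity of `u ↦ Φ(e u)`, one sees that `x'(Φ(e ⟨f, g⟩) x)` is the trace of `Φ_γ(g) x`
against `Φ_γ'(f) (x' ∘ Φ(e))`. If `y = Φ_γ'(f)' Φ_γ(g) x`, this trace is `x'(Φ(e) y)` as well, so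
that `y = Φ(⟨f, g⟩) x`.

Such a `y` exists because `Φ_γ'(f)'` maps all of `γ(H;X)` into `X`: boundedness of `Φ_γ'(f)` makes
each `Φ(⟨f, h'⟩)` everywhere defined, by the uniform boundedness principle and closedness of its
graph, which settles finite rank operators; the rest follows by `γ`-approximation and completeness.
-/

namespace SquareFn

universe u v

theorem norm_le_of_enorm_le_mul_of_le {E F : Type*} [SeminormedAddGroup E] [SeminormedAddGroup F]
    {K L : ℝ≥0} {a : ℝ≥0∞} {x : E} {y : F} (hy : ‖y‖ₑ ≤ K * a) (ha : a ≤ L * ‖x‖ₑ) :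
    ‖y‖ ≤ (K * L : ℝ≥0) * ‖x‖ := by
  have h : ‖y‖ₑ ≤ K * (L * ‖x‖ₑ) := hy.trans (by gcongr)
  rw [← mul_assoc, ← ENNReal.coe_mul, enorm_eq_nnnorm, enorm_eq_nnnorm, ← ENNReal.coe_mul,
    ENNReal.coe_le_coe] at h
  exact_mod_cast h

theorem inv_add_one_mul_le {K : ℝ≥0} {a b : ℝ≥0∞} (h : a ≤ K * b) :
    ((K + 1)⁻¹ : ℝ≥0) * a ≤ b := by
  rw [ENNReal.coe_inv (by positivity), mul_comm, ← div_eq_mul_inv]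
  exact ENNReal.div_le_of_le_mul' (h.trans (by gcongr; exact le_self_add))

theorem cauchySeq_of_edist_le_add {E ι : Type*} [PseudoEMetricSpace E] [Nonempty ι]
    [SemilatticeSup ι] {z : ι → E} {β : ι → ℝ≥0∞} (h : ∀ m n, edist (z m) (z n) ≤ β m + β n)
    (hβ : Tendsto β atTop (𝓝 0)) : CauchySeq z := by
  refine EMetric.cauchySeq_iff.2 fun ε hε => ?_
  obtain ⟨N, hN⟩ := eventually_atTop.1 (hβ.eventually_lt_const (ENNReal.half_pos hε.ne'))
  refine ⟨N, fun m hm n hn => (h m n).trans_lt ?_⟩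
  exact (ENNReal.add_lt_add (hN m hm) (hN n hn)).trans_eq (ENNReal.add_halves ε)

section Banach

variable {𝕜 E F : Type*} [RCLike 𝕜] [NormedAddCommGroup E] [NormedSpace 𝕜 E]
  [NormedAddCommGroup F] [NormedSpace 𝕜 F]

theorem enorm_le_of_forall_dual_le {M : ℝ≥0∞} {y : E}
    (h : ∀ y' : StrongDual 𝕜 E, ‖y' y‖ₑ ≤ M * ‖y'‖ₑ) : ‖y‖ₑ ≤ M := by
  obtain ⟨y', hy', hy⟩ := exists_dual_vector'' 𝕜 y
  calc ‖y‖ₑ = ‖y' y‖ₑ := by rw [hy, ← ofReal_norm, ← ofReal_norm, RCLike.norm_coe_norm]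
    _ ≤ M * ‖y'‖ₑ := h y'
    _ ≤ M * 1 := by
        gcongr
        simpa using (enorm_le_iff_norm_le (x := y') (y := (1 : ℝ))).2 (by simpa using hy')
    _ = M := mul_one M

theorem exists_norm_le_of_forall_dual_bounded {ι : Type*} {u : ι → E}
    (h : ∀ x' : StrongDual 𝕜 E, ∃ C : ℝ, ∀ i, ‖x' (u i)‖ ≤ C) : ∃ C : ℝ, ∀ i, ‖u i‖ ≤ C := by
  obtain ⟨C, hC⟩ := banach_steinhaus (g := fun i => NormedSpace.inclusionInDoubleDual 𝕜 E (u i)) h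
  exact ⟨C, fun i => ((NormedSpace.inclusionInDoubleDualLi (E := E) 𝕜).norm_map (u i)).ge.trans
    (hC i)⟩

theorem exists_norm_apply_le_of_adjoint (A : E →ₗ.[𝕜] F)
    (hA : ∀ y' : StrongDual 𝕜 F, ∃ x' : StrongDual 𝕜 E, ∀ x : A.domain, y' (A x) = x' x) :
    ∃ C : ℝ, ∀ x : A.domain, ‖A x‖ ≤ C * ‖x‖ := by
  obtain ⟨C, hC⟩ := exists_norm_le_of_forall_dual_bounded (𝕜 := 𝕜)
    (u := fun x : Metric.ball (0 : A.domain) 1 => A x.1) fun y' => by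
      obtain ⟨x', hx'⟩ := hA y'
      refine ⟨‖x'‖, fun x => ?_⟩
      rw [hx']
      exact x'.unit_le_opNorm _ (mem_ball_zero_iff.1 x.2).le
  exact LinearMap.bound_of_ball_bound one_pos C A.toFun fun x hx => hC ⟨x, hx⟩

theorem isClosed_domain_of_norm_apply_le [CompleteSpace E] [CompleteSpace F] (A : E →ₗ.[𝕜] F)
    (hcl : IsClosed (A.graph : Set (E × F))) {C : ℝ} (hC : ∀ x : A.domain, ‖A x‖ ≤ C * ‖x‖) :
    IsClosed (A.domain : Set E) := by
  have : CompleteSpace A.graph := hcl.completeSpace_coe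
  let P : A.graph →L[𝕜] E := (ContinuousLinearMap.fst 𝕜 E F).comp A.graph.subtypeL
  have hP : AntilipschitzWith (max 1 C).toNNReal P := by
    refine P.antilipschitz_of_bound fun p => ?_
    obtain ⟨x, hx1, hx2⟩ := A.mem_graph_iff.1 p.2
    have : P p = x := hx1.symm
    rw [this, Real.coe_toNNReal _ (by positivity)]
    change max ‖p.1.1‖ ‖p.1.2‖ ≤ _
    rw [← hx1, ← hx2, max_mul_of_nonneg _ _ (by positivity), one_mul]
    exact max_le_max le_rfl (hC x)
  have hrange : Set.range P = A.domain := by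
    rw [← A.graph_map_fst_eq_domain]
    ext; simp [P]
  rw [← hrange]
  exact hP.isClosed_range P.uniformContinuous

theorem domain_eq_top_of_adjoint [CompleteSpace E] [CompleteSpace F] (A : E →ₗ.[𝕜] F)
    (hcl : IsClosed (A.graph : Set (E × F))) (hd : Dense (A.domain : Set E))
    (hA : ∀ y' : StrongDual 𝕜 F, ∃ x' : StrongDual 𝕜 E, ∀ x : A.domain, y' (A x) = x' x) :
    A.domain = ⊤ := by
  obtain ⟨C, hC⟩ := exists_norm_apply_le_of_adjoint A hA
  rw [← SetLike.coe_set_eq, Submodule.top_coe, ← hd.closure_eq]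
  exact (isClosed_domain_of_norm_apply_le A hcl hC).closure_eq.symm

end Banach

theorem countable_setOf_ne_zero_of_summable {α ι E : Type*} [TopologicalSpace α]
    [TopologicalSpace.SeparableSpace α] [NormedAddCommGroup E] {p : ι → α → E}
    (hc : ∀ i, Continuous (p i)) (hs : ∀ z, Summable fun i => p i z) : {i | p i ≠ 0}.Countable := by
  obtain ⟨D, hDc, hD⟩ := TopologicalSpace.exists_countable_dense α
  refine (hDc.biUnion fun z _ => (hs z).countable_support).mono fun i hi => ?_
  by_contra h
  simp only [Set.mem_iUnion, Function.mem_support, not_exists, not_not] at h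
  exact hi (Continuous.ext_on hD (hc i) continuous_const h)

section BoundedLimits

variable {E ι : Type*} [NormedAddCommGroup E] [NormedSpace ℂ E] {Ω : Set ℂ} {u : ι → ℂ → E}
  {K : ℝ}

theorem equicontinuousAt_of_differentiableOn_of_norm_le {c : ℂ} (hΩ : Ω ∈ 𝓝 c)
    (hu : ∀ i, DifferentiableOn ℂ (u i) Ω) (hK : ∀ i, ∀ z ∈ Ω, ‖u i z‖ ≤ K) :
    EquicontinuousAt u c := by
  obtain ⟨r, hr, hrΩ⟩ := Metric.mem_nhds_iff.1 hΩ
  refine Metric.equicontinuousAt_of_continuity_modulus (fun z => (K + K) / r * dist z c) ?_ _ ?_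
  · exact (Continuous.tendsto' (by fun_prop) _ _ (by simp))
  · filter_upwards [Metric.ball_mem_nhds c hr] with z hz i
    rw [dist_comm]
    refine Complex.dist_le_div_mul_dist_of_mapsTo_ball ((hu i).mono hrΩ) (fun w hw => ?_) hz
    exact (dist_le_norm_add_norm _ _).trans
      (add_le_add (hK i w (hrΩ hw)) (hK i c (mem_of_mem_nhds hΩ)))

theorem tendstoLocallyUniformlyOn_of_norm_le_of_tendsto {l : Filter ι} {u₀ : ℂ → E}
    (hΩ : IsOpen Ω) (hu : ∀ i, DifferentiableOn ℂ (u i) Ω) (hK : ∀ i, ∀ z ∈ Ω, ‖u i z‖ ≤ K)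
    (hlim : ∀ z ∈ Ω, Tendsto (fun i => u i z) l (𝓝 (u₀ z))) :
    TendstoLocallyUniformlyOn u u₀ l Ω := by
  refine (tendstoLocallyUniformlyOn_iff_forall_isCompact hΩ).2 fun A hAΩ hA => ?_
  have heq : EquicontinuousOn u A := fun c hc =>
    (equicontinuousAt_of_differentiableOn_of_norm_le (hΩ.mem_nhds (hAΩ hc)) hu
      hK).equicontinuousWithinAt A
  have h := (EquicontinuousOn.tendsto_uniformOnFun_iff_pi' (𝔖 := {A}) (by simpa using hA)
    (by simpa using heq) l u₀).2 (tendsto_pi_nhds.2 fun z => hlim z (hAΩ (by simpa using z.2)))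
  exact UniformOnFun.tendsto_iff_tendstoUniformlyOn.1 h A rfl

namespace HInfty

theorem mem_of_tendsto {l : Filter ι} [l.NeBot] (hΩ : IsOpen Ω) {s : ι → Ω → ℂ} {s₀ : Ω → ℂ}
    (hs : ∀ i, s i ∈ HInfty Ω) (hK : ∀ i z, ‖s i z‖ ≤ K)
    (hlim : ∀ z, Tendsto (fun i => s i z) l (𝓝 (s₀ z))) : s₀ ∈ HInfty Ω := by
  choose G hG hGs using fun i => (hs i).1
  let G₀ : ℂ → ℂ := Function.extend Subtype.val s₀ 0
  have hG₀ : ∀ z : Ω, G₀ z = s₀ z := Subtype.val_injective.extend_apply s₀ 0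
  have hlu : TendstoLocallyUniformlyOn G G₀ l Ω :=
    tendstoLocallyUniformlyOn_of_norm_le_of_tendsto hΩ hG
      (fun i z hz => (congrArg norm (hGs i ⟨z, hz⟩)).trans_le (hK i ⟨z, hz⟩))
      fun z hz => by simpa only [hGs _ ⟨z, hz⟩, hG₀ ⟨z, hz⟩] using hlim ⟨z, hz⟩
  exact ⟨⟨G₀, hlu.differentiableOn (Eventually.of_forall hG) hΩ, hG₀⟩, K, fun z =>
    le_of_tendsto (hlim z).norm (Eventually.of_forall fun i => hK i z)⟩

theorem continuous {s : Ω → ℂ} (hs : s ∈ HInfty Ω) : Continuous s := by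
  obtain ⟨⟨G, hG, hGs⟩, -⟩ := hs
  exact hG.continuousOn.domRestrict.congr hGs

end HInfty

end BoundedLimits

section GammaNorm

variable {H X : Type*} [NormedAddCommGroup H] [InnerProductSpace ℂ H]
  [NormedAddCommGroup X] [NormedSpace ℂ X]

theorem gammaNorm_neg (T : H →L[ℂ] X) : gammaNorm (-T) = gammaNorm T := by
  have h : ∀ S : H →L[ℂ] X, gammaNorm (-S) ≤ gammaNorm S := fun S => by
    simpa using gammaNorm_smul_le (-1 : ℂ) S
  exact le_antisymm (h T) (by simpa using h (-T))

theorem gammaNorm_sub_le (S T : H →L[ℂ] X) :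
    gammaNorm (S - T) ≤ gammaNorm S + gammaNorm T := by
  simpa only [sub_eq_add_neg, gammaNorm_neg] using gammaNorm_add_le S (-T)

theorem gammaNorm_comp_isometry_le {H' : Type*} [NormedAddCommGroup H'] [InnerProductSpace ℂ H']
    (T : H →L[ℂ] X) (R : H' →ₗᵢ[ℂ] H) :
    gammaNorm (T.comp R.toContinuousLinearMap) ≤ gammaNorm T :=
  iSup_le fun n => iSup_le fun e => iSup_le fun he =>
    le_iSup_of_le n (le_iSup_of_le (R ∘ e) (le_iSup_of_le (he.comp_linearIsometry R) le_rfl))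

theorem gammaNorm_comp_starProjection_le (T : H →L[ℂ] X) (K : Submodule ℂ H)
    [K.HasOrthogonalProjection] : gammaNorm (T.comp K.starProjection) ≤ gammaNorm T := by
  -- The projection is the mean of the identity and a reflection, and reflections are isometries.
  let R := T.comp K.reflection.toLinearIsometry.toContinuousLinearMap
  have hmean : T.comp K.starProjection = (2⁻¹ : ℂ) • (T + R) := by
    ext v
    simp only [R, ContinuousLinearMap.comp_apply, smul_apply, add_apply,
      LinearIsometry.coe_toContinuousLinearMap, LinearIsometryEquiv.coe_toLinearIsometry,
      Submodule.reflection_apply, map_sub, two_smul, map_add]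
    module
  have h2 : ‖(2⁻¹ : ℂ)‖ₑ * 2 = 1 := by
    have : ‖(2 : ℂ)‖ₑ = 2 := by simp [enorm_eq_nnnorm]
    rw [enorm_inv two_ne_zero, this]
    exact ENNReal.inv_mul_cancel two_ne_zero ENNReal.ofNat_ne_top
  calc gammaNorm (T.comp K.starProjection) ≤ ‖(2⁻¹ : ℂ)‖ₑ * gammaNorm (T + R) := by
        rw [hmean]; exact gammaNorm_smul_le _ _
    _ ≤ ‖(2⁻¹ : ℂ)‖ₑ * (gammaNorm T + gammaNorm T) := by
        gcongr
        exact (gammaNorm_add_le T R).trans (by gcongr; exact gammaNorm_comp_isometry_le T _)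
    _ = gammaNorm T := by rw [← two_mul, ← mul_assoc, h2, one_mul]

theorem IsFiniteRank.exists_eq_sum_smulRight {S : H →L[ℂ] X} (hS : IsFiniteRank S) :
    ∃ (n : ℕ) (g : Fin n → StrongDual ℂ H) (x : Fin n → X), S = ∑ j, (g j).smulRight (x j) := by
  have : FiniteDimensional ℂ (LinearMap.range (S : H →ₗ[ℂ] X)) := hS
  let B := Module.finBasis ℂ (LinearMap.range (S : H →ₗ[ℂ] X))
  let S' : H →L[ℂ] LinearMap.range (S : H →ₗ[ℂ] X) := S.codRestrict _ fun h => ⟨h, rfl⟩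
  refine ⟨_, fun j => (B.coord j).toContinuousLinearMap.comp S', fun j => B j, ?_⟩
  ext h
  have hsum := congrArg Subtype.val (B.sum_repr (S' h))
  rw [Submodule.coe_sum] at hsum
  simp only [sum_apply, ContinuousLinearMap.smulRight_apply, ContinuousLinearMap.comp_apply,
    LinearMap.coe_toContinuousLinearMap', Module.Basis.coord_apply]
  exact hsum.symm

theorem IsFiniteRank.mem_gammaRad {S : H →L[ℂ] X} (hS : IsFiniteRank S) (hγ : gammaNorm S < ∞) :
    S ∈ gammaRad H X :=
  ⟨hγ, fun ε hε => ⟨S, hS, by simpa [gammaNorm_zero] using hε⟩⟩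

theorem exists_seq_isFiniteRank_tendsto (U : gammaRad H X) :
    ∃ W : ℕ → gammaRad H X, (∀ n, IsFiniteRank (W n).1) ∧
      Tendsto (fun n => gammaNorm (U - W n).1) atTop (𝓝 0) := by
  choose S hS hUS using fun n : ℕ => U.2.2 (n : ℝ≥0∞)⁻¹ (by simp)
  have hfin : ∀ n, gammaNorm (S n) < ∞ := fun n => by
    rw [← sub_sub_cancel U.1 (S n)]
    exact (gammaNorm_sub_le _ _).trans_lt (ENNReal.add_lt_top.2 ⟨U.2.1, (hUS n).trans_le le_top⟩)
  exact ⟨fun n => ⟨S n, (hS n).mem_gammaRad (hfin n)⟩, hS,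
    tendsto_of_tendsto_of_tendsto_of_le_of_le tendsto_const_nhds
      ENNReal.tendsto_inv_nat_nhds_zero (fun _ => zero_le) fun n => (hUS n).le⟩

end GammaNorm

section Orthonormal

variable {𝕜 H ι : Type*} [RCLike 𝕜] [NormedAddCommGroup H] [InnerProductSpace 𝕜 H] {b : ι → H}

theorem starProjection_span_image_apply [DecidableEq H] (hb : Orthonormal 𝕜 b) (s : Finset ι)
    (v : H) : (Submodule.span 𝕜 (s.image b : Set H)).starProjection v =
      ∑ i ∈ s, inner 𝕜 (b i) v • b i := by
  rw [(OrthonormalBasis.span hb s).starProjection_eq_sum_rankOne, sum_apply,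
    ← Finset.sum_coe_sort s fun i => inner 𝕜 (b i) v • b i]
  simp

theorem norm_sum_inner_smul_le (hb : Orthonormal 𝕜 b) (s : Finset ι) (v : H) :
    ‖∑ i ∈ s, inner 𝕜 (b i) v • b i‖ ≤ ‖v‖ := by
  classical
  rw [← starProjection_span_image_apply hb]
  exact Submodule.norm_starProjection_apply_le _ v

end Orthonormal

section TraceEstimates

variable {H X ι : Type*} [NormedAddCommGroup H] [InnerProductSpace ℂ H]
  [NormedAddCommGroup X] [NormedSpace ℂ X]

theorem enorm_sum_apply_le_gammaDualNorm [Fintype ι] (V : StrongDual ℂ H →L[ℂ] StrongDual ℂ X)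
    (g : ι → StrongDual ℂ H) (x : ι → X) (h : gammaNorm (∑ i, (g i).smulRight (x i)) ≤ 1) :
    ‖∑ i, V (g i) (x i)‖ₑ ≤ gammaDualNorm V := by
  let φ := (Fintype.equivFin ι).symm
  rw [← φ.sum_comp] at h ⊢
  exact le_iSup_of_le _ (le_iSup_of_le (g ∘ φ) (le_iSup_of_le (x ∘ φ) (le_iSup_of_le h le_rfl)))

theorem enorm_sum_apply_le_of_gammaNorm_le [Fintype ι] (V : StrongDual ℂ H →L[ℂ] StrongDual ℂ X)
    (g : ι → StrongDual ℂ H) (x : ι → X) {r : ℝ≥0} (hr : r ≠ 0)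
    (h : gammaNorm (∑ i, (g i).smulRight (x i)) ≤ r) :
    ‖∑ i, V (g i) (x i)‖ₑ ≤ gammaDualNorm V * r := by
  have hr' : ((r : ℝ) : ℂ) ≠ 0 := by simpa using hr
  have hre : ‖((r : ℝ) : ℂ)‖ₑ = r := by simp [enorm_eq_nnnorm]
  have hscaled : ‖∑ i, V (g i) (((r : ℝ) : ℂ)⁻¹ • x i)‖ₑ ≤ gammaDualNorm V := by
    refine enorm_sum_apply_le_gammaDualNorm V g _ ?_
    have hsmul : ∑ i, (g i).smulRight (((r : ℝ) : ℂ)⁻¹ • x i) =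
        ((r : ℝ) : ℂ)⁻¹ • ∑ i, (g i).smulRight (x i) := by
      rw [Finset.smul_sum]
      refine Finset.sum_congr rfl fun i _ => ?_
      ext v
      exact smul_comm _ _ _
    calc gammaNorm (∑ i, (g i).smulRight (((r : ℝ) : ℂ)⁻¹ • x i))
        ≤ (r : ℝ≥0∞)⁻¹ * r := by
          rw [hsmul, ← hre, ← enorm_inv hr', hre]
          exact (gammaNorm_smul_le _ _).trans (by gcongr)
      _ = 1 := ENNReal.inv_mul_cancel (by simpa using hr) (by simp)
  calc ‖∑ i, V (g i) (x i)‖ₑ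
      = ‖∑ i, V (g i) (((r : ℝ) : ℂ)⁻¹ • x i)‖ₑ * r := by
        simp only [map_smul, ← Finset.smul_sum]
        rw [enorm_smul, enorm_inv hr', hre, mul_right_comm,
          ENNReal.inv_mul_cancel (by simpa using hr) (by simp), one_mul]
    _ ≤ gammaDualNorm V * r := by gcongr

theorem enorm_sum_trace_le {b : ι → H} (hb : Orthonormal ℂ b) (U : gammaRad H X)
    (V : gammaDual H X) (s : Finset ι) :
    ‖∑ i ∈ s, V.1 (innerSL ℂ (b i)) (U.1 (b i))‖ₑ ≤ gammaDualNorm V.1 * gammaNorm U.1 := by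
  classical
  have hcomp : ∑ i : s, (innerSL ℂ (b i)).smulRight (U.1 (b i)) =
      U.1.comp (Submodule.span ℂ (s.image b : Set H)).starProjection := by
    ext v
    rw [ContinuousLinearMap.comp_apply, starProjection_span_image_apply hb, map_sum,
      ← Finset.sum_coe_sort s fun i => U.1 (inner ℂ (b i) v • b i)]
    simp
  rw [← Finset.sum_coe_sort]
  refine ENNReal.le_mul_of_forall_lt (.inr U.2.1.ne) (.inl V.2.ne) fun M hM r hr => ?_
  rcases eq_or_ne r ∞ with rfl | hrtop
  · simp [ENNReal.mul_top (pos_of_gt hM).ne']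
  lift r to ℝ≥0 using hrtop
  have hr0 : r ≠ 0 := by simpa using (pos_of_gt hr).ne'
  have hγ := hcomp.symm ▸ (gammaNorm_comp_starProjection_le U.1 _).trans hr.le
  exact (enorm_sum_apply_le_of_gammaNorm_le V.1 _ _ hr0 hγ).trans (by gcongr)

end TraceEstimates

section Expansions

variable {𝕜 H ι : Type*} [RCLike 𝕜] [NormedAddCommGroup H] [InnerProductSpace 𝕜 H]

theorem hasSum_inner_mul_apply (b : HilbertBasis ι 𝕜 H) (v : H) (φ : StrongDual 𝕜 H) :
    HasSum (fun i => innerSL 𝕜 (b i) v * φ (b i)) (φ v) := by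
  simpa [b.repr_apply_apply] using (b.hasSum_repr v).mapL φ

theorem hasSum_apply_smul_innerSL [CompleteSpace H] (b : HilbertBasis ι 𝕜 H)
    (φ : StrongDual 𝕜 H) : HasSum (fun i => φ (b i) • innerSL 𝕜 (b i)) φ := by
  obtain ⟨w, rfl⟩ := (InnerProductSpace.toDual 𝕜 H).surjective φ
  refine ((b.hasSum_repr w).map (InnerProductSpace.toDual 𝕜 H)
    (InnerProductSpace.toDual 𝕜 H).continuous).congr_fun fun i => ?_
  rw [Function.comp_apply, map_smulₛₗ, b.repr_apply_apply, inner_conj_symm]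
  rfl

end Expansions

section TraceDuality

variable {H : Type u} [NormedAddCommGroup H] [InnerProductSpace ℂ H]
  {X : Type v} [NormedAddCommGroup X] [NormedSpace ℂ X]

theorem hasSum_trace_sum_smulRight [CompleteSpace H] {ι κ : Type*} [Fintype κ]
    (b : HilbertBasis ι ℂ H) (V : StrongDual ℂ H →L[ℂ] StrongDual ℂ X) (g : κ → StrongDual ℂ H)
    (x : κ → X) :
    HasSum (fun i => V (innerSL ℂ (b i)) ((∑ j, (g j).smulRight (x j)) (b i)))
      (∑ j, V (g j) (x j)) := by
  simp only [sum_apply, ContinuousLinearMap.smulRight_apply, map_sum]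
  refine hasSum_sum fun j _ => ?_
  have h := ((hasSum_apply_smul_innerSL b (g j)).mapL V).mapL
    (ContinuousLinearMap.apply ℂ ℂ (x j))
  simpa only [map_smul, ContinuousLinearMap.apply_apply, smul_apply, smul_eq_mul] using h

namespace HasTraceDuality

variable {U₁ U₂ U : gammaRad H X} {V : gammaDual H X} {s t : ℂ}

theorem enorm_le [CompleteSpace H] (h : HasTraceDuality U V t) :
    ‖t‖ₑ ≤ gammaDualNorm V.1 * gammaNorm U.1 := by
  obtain ⟨w, b, -⟩ := exists_hilbertBasis ℂ H
  exact le_of_tendsto (h w b).enorm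
    (Eventually.of_forall fun s => enorm_sum_trace_le b.orthonormal U V s)

theorem sub (h₁ : HasTraceDuality U₁ V s) (h₂ : HasTraceDuality U₂ V t) :
    HasTraceDuality (U₁ - U₂) V (s - t) := fun ι b => by
  simpa using (h₁ ι b).sub (h₂ ι b)

theorem of_tendsto {κ : Type*} {l : Filter κ} [l.NeBot] {W : κ → gammaRad H X} {τ : κ → ℂ}
    (hW : Tendsto (fun k => gammaNorm (U - W k).1) l (𝓝 0)) (hτ : Tendsto τ l (𝓝 t))
    (h : ∀ k, HasTraceDuality (W k) V (τ k)) : HasTraceDuality U V t := fun ι b => by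
  have hbound : Tendsto (fun k => gammaDualNorm V.1 * gammaNorm (U - W k).1) l (𝓝 0) := by
    simpa using ENNReal.Tendsto.const_mul hW (.inr V.2.ne)
  have hunif : TendstoUniformly
      (fun k (s : Finset ι) => ∑ i ∈ s, V.1 (innerSL ℂ (b i)) ((W k).1 (b i)))
      (fun s => ∑ i ∈ s, V.1 (innerSL ℂ (b i)) (U.1 (b i))) l := by
    refine EMetric.tendstoUniformly_iff.2 fun ε hε => ?_
    filter_upwards [hbound.eventually_lt_const hε] with k hk s
    refine lt_of_le_of_lt ?_ hk
    simpa [edist_eq_enorm_sub] using enorm_sum_trace_le b.orthonormal (U - W k) V s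
  exact hunif.tendsto_of_eventually_tendsto (Eventually.of_forall fun k => h k ι b) hτ

end HasTraceDuality

section Adjoint

variable {B : StrongDual ℂ X →ₗ.[ℂ] gammaDual H X} {U₁ U₂ U : gammaRad H X} {y₁ y₂ y : X}
  {K : ℝ≥0}

theorem enorm_le_of_mem_traceAdjointGraph [CompleteSpace H] (htop : B.domain = ⊤)
    (hK : ∀ x' : B.domain, gammaDualNorm (B x').1 ≤ K * ‖(x' : StrongDual ℂ X)‖ₑ)
    (hy : (U, y) ∈ traceAdjointGraph B) : ‖y‖ₑ ≤ K * gammaNorm U.1 := by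
  refine enorm_le_of_forall_dual_le (𝕜 := ℂ) fun x' => ?_
  lift x' to B.domain using htop ▸ Submodule.mem_top
  calc ‖x'.1 y‖ₑ ≤ gammaDualNorm (B x').1 * gammaNorm U.1 := (hy x').enorm_le
    _ ≤ K * ‖(x' : StrongDual ℂ X)‖ₑ * gammaNorm U.1 := by gcongr; exact hK x'
    _ = K * gammaNorm U.1 * ‖(x' : StrongDual ℂ X)‖ₑ := mul_right_comm _ _ _

theorem sub_mem_traceAdjointGraph (h₁ : (U₁, y₁) ∈ traceAdjointGraph B)
    (h₂ : (U₂, y₂) ∈ traceAdjointGraph B) : (U₁ - U₂, y₁ - y₂) ∈ traceAdjointGraph B :=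
  fun x' => by simpa only [map_sub] using (h₁ x').sub (h₂ x')

theorem mem_traceAdjointGraph_of_tendsto {κ : Type*} {l : Filter κ} [l.NeBot]
    {W : κ → gammaRad H X} {z : κ → X} (hW : Tendsto (fun k => gammaNorm (U - W k).1) l (𝓝 0))
    (hz : Tendsto z l (𝓝 y)) (h : ∀ k, (W k, z k) ∈ traceAdjointGraph B) :
    (U, y) ∈ traceAdjointGraph B := fun x' =>
  HasTraceDuality.of_tendsto hW ((x'.1.continuous.tendsto y).comp hz) fun k => h k x'

theorem exists_mem_traceAdjointGraph_of_isFiniteRank [CompleteSpace H]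
    (hB : ∀ (h' : StrongDual ℂ H) (x : X), ∃ y : X, ∀ x' : B.domain, x'.1 y = (B x').1 h' x)
    (hU : IsFiniteRank U.1) : ∃ y, (U, y) ∈ traceAdjointGraph B := by
  choose A hA using hB
  obtain ⟨n, g, x, hUgx⟩ := hU.exists_eq_sum_smulRight
  refine ⟨∑ j, A (g j) (x j), fun x' ι b => ?_⟩
  simpa only [map_sum, hA, ← hUgx] using hasSum_trace_sum_smulRight b (B x').1 g x

theorem exists_mem_traceAdjointGraph [CompleteSpace H] [CompleteSpace X]
    (htop : B.domain = ⊤)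
    (hK : ∀ x' : B.domain, gammaDualNorm (B x').1 ≤ K * ‖(x' : StrongDual ℂ X)‖ₑ)
    (hB : ∀ (h' : StrongDual ℂ H) (x : X), ∃ y : X, ∀ x' : B.domain, x'.1 y = (B x').1 h' x)
    (U : gammaRad H X) : ∃ y, (U, y) ∈ traceAdjointGraph B := by
  obtain ⟨W, hWfin, hW⟩ := exists_seq_isFiniteRank_tendsto U
  choose z hz using fun n => exists_mem_traceAdjointGraph_of_isFiniteRank hB (hWfin n)
  have hedist : ∀ m n, edist (z m) (z n) ≤
      K * gammaNorm (U - W m).1 + K * gammaNorm (U - W n).1 := fun m n => by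
    rw [edist_comm, edist_eq_enorm_sub, ← mul_add]
    refine (enorm_le_of_mem_traceAdjointGraph htop hK
      (sub_mem_traceAdjointGraph (hz n) (hz m))).trans ?_
    gcongr
    rw [← sub_sub_sub_cancel_left (W m) (W n) U]
    exact gammaNorm_sub_le _ _
  have hcauchy : CauchySeq z := cauchySeq_of_edist_le_add hedist <| by
    simpa using ENNReal.Tendsto.const_mul hW (.inr ENNReal.coe_ne_top)
  obtain ⟨y, hy⟩ := cauchySeq_tendsto_of_complete hcauchy
  exact ⟨y, mem_traceAdjointGraph_of_tendsto hW hy hz⟩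

end Adjoint

end TraceDuality

section Graphs

variable {X : Type*} [NormedAddCommGroup X] [NormedSpace ℂ X]

theorem mem_graph_adjointOp {A : X →ₗ.[ℂ] X} (hd : Dense (A.domain : Set X))
    {x' z' : StrongDual ℂ X} :
    (x', z') ∈ (adjointOp A).graph ↔ ∀ x : A.domain, x' (A x) = z' x := by
  rw [adjointOp, Submodule.toLinearPMap_graph_eq]
  · rfl
  · rintro ⟨p, q⟩ hp (rfl : p = 0)
    refine DFunLike.coe_injective (Continuous.ext_on hd q.continuous continuous_const ?_)
    exact fun x hx => (hp ⟨x, hx⟩).symm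

namespace FunctionalCalculus

variable {S : Type*} {F : Subalgebra ℂ (S → ℂ)} {C : FunctionalCalculus F X}
  {H : Type*} [NormedAddCommGroup H] [InnerProductSpace ℂ H]

theorem mem_graph_PhiGamma {g : S → StrongDual ℂ H} {x : X} {U : gammaRad H X} :
    (x, U) ∈ (C.PhiGamma g).graph ↔ ∀ h, (x, U.1 h) ∈ (C.Phi fun z => g z h).graph := by
  rw [PhiGamma, Submodule.toLinearPMap_graph_eq]
  · rfl
  · rintro ⟨x, U⟩ hp hx
    exact Subtype.ext (ContinuousLinearMap.ext fun h =>
      LinearPMap.graph_fst_eq_zero_snd _ (hp h) hx)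

theorem mem_graph_PhiGammaDual {f : S → H} {x' : StrongDual ℂ X} {V : gammaDual H X} :
    (x', V) ∈ (C.PhiGammaDual f).graph ↔
      ∀ h', (x', V.1 h') ∈ (adjointOp (C.Phi fun z => h' (f z))).graph := by
  rw [PhiGammaDual, Submodule.toLinearPMap_graph_eq]
  · rfl
  · rintro ⟨x', V⟩ hp hx
    exact Subtype.ext (ContinuousLinearMap.ext fun h' =>
      LinearPMap.graph_fst_eq_zero_snd _ (hp h') hx)

theorem PhiGammaDual_apply_Phi {f : S → H} (hfd : C.DualWellDefined f)
    (x' : (C.PhiGammaDual f).domain) (h' : StrongDual ℂ H)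
    (x : (C.Phi fun z => h' (f z)).domain) :
    (C.PhiGammaDual f x').1 h' x = x'.1 (C.Phi (fun z => h' (f z)) x) :=
  ((mem_graph_adjointOp (hfd h')).1
    (mem_graph_PhiGammaDual.1 ((C.PhiGammaDual f).mem_graph x') h') x).symm

theorem isClosed_graph_Phi {f : S → ℂ} {e : C.E} (he : C.IsRegulariser e f) :
    IsClosed ((C.Phi f).graph : Set (X × X)) := by
  have : ((C.Phi f).graph : Set (X × X)) =
      {p | C.Φ e p.2 = C.Φ ⟨(e : S → ℂ) * f, he.1⟩ p.1} :=
    Set.ext fun p => C.mem_graph_Phi_iff he p.1 p.2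
  rw [this]
  exact isClosed_eq (by fun_prop) (by fun_prop)

theorem domain_Phi_eq_top [CompleteSpace X] {f : S → H} (hfd : C.DualWellDefined f)
    (htop : (C.PhiGammaDual f).domain = ⊤) (h' : StrongDual ℂ H) {e : C.E}
    (he : C.IsRegulariser e fun z => h' (f z)) : (C.Phi fun z => h' (f z)).domain = ⊤ :=
  domain_eq_top_of_adjoint _ (isClosed_graph_Phi he) (hfd h') fun x' =>
    ⟨_, fun x => (PhiGammaDual_apply_Phi hfd ⟨x', htop ▸ Submodule.mem_top⟩ h' x).symm⟩

theorem Phi_apply_of_eq_one {u : S → ℂ} (hu : u = 1) {e : C.E} (he : C.IsRegulariser e u)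
    (x : (C.Phi u).domain) : C.Phi u x = x := by
  subst hu
  refine he.2 ?_
  simpa only [mul_one, Subtype.coe_eta] using
    (C.mem_graph_Phi_iff he x _).1 ((C.Phi 1).mem_graph x)

theorem apply_mul_of_mem_graph_Phi {u v : S → ℂ} {e : C.E} (hu : C.IsRegulariser e u)
    (hv : C.IsRegulariser e v) (huv : (e : S → ℂ) * (u * v) ∈ C.E) {x y : X}
    (h : (x, y) ∈ (C.Phi v).graph) :
    C.Φ ⟨(e : S → ℂ) * u, hu.1⟩ y = C.Φ ⟨(e : S → ℂ) * (u * v), huv⟩ x := by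
  let eu : C.E := ⟨(e : S → ℂ) * u, hu.1⟩
  let ev : C.E := ⟨(e : S → ℂ) * v, hv.1⟩
  let euv : C.E := ⟨(e : S → ℂ) * (u * v), huv⟩
  have hprod : eu * ev = e * euv :=
    Subtype.ext (by change ((e : S → ℂ) * u) * (e * v) = e * (e * (u * v)); ring)
  refine hu.2 ?_
  calc C.Φ e (C.Φ eu y) = C.Φ eu (C.Φ e y) := by
        rw [← mul_apply_eq_comp, ← mul_apply_eq_comp, ← map_mul, ← map_mul, mul_comm]
    _ = C.Φ eu (C.Φ ev x) := by rw [(C.mem_graph_Phi_iff hv x y).1 h]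
    _ = C.Φ e (C.Φ euv x) := by
        rw [← mul_apply_eq_comp, ← mul_apply_eq_comp, ← map_mul, ← map_mul, hprod]

theorem PhiGammaDual_apply_of_eq_comp {f : S → H} (hfd : C.DualWellDefined f) {e : C.E}
    {h' : StrongDual ℂ H} (he : C.IsRegulariser e fun z => h' (f z)) {x' : StrongDual ℂ X}
    {y' : (C.PhiGammaDual f).domain} (hy' : y'.1 = x'.comp (C.Φ e)) :
    (C.PhiGammaDual f y').1 h' = x'.comp (C.Φ ⟨(e : S → ℂ) * fun z => h' (f z), he.1⟩) := by
  refine DFunLike.coe_injective (Continuous.ext_on (hfd h') (map_continuous _)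
    (map_continuous _) fun x hx => ?_)
  have hgraph := (C.mem_graph_Phi_iff he x _).1 ((C.Phi _).mem_graph ⟨x, hx⟩)
  simp only [PhiGammaDual_apply_Phi hfd y' h' ⟨x, hx⟩, hy', ContinuousLinearMap.comp_apply, hgraph]

end FunctionalCalculus

end Graphs

section Composition

variable {H X : Type*} [NormedAddCommGroup H] [InnerProductSpace ℂ H]
  [NormedAddCommGroup X] [NormedSpace ℂ X] {A : X →ₗ.[ℂ] X} {G : X →ₗ.[ℂ] gammaRad H X}
  {B : StrongDual ℂ X →ₗ.[ℂ] gammaDual H X}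

theorem domain_le_of_traceAdjointGraph_comp_le
    (hB : ∀ U : gammaRad H X, ∃ y, (U, y) ∈ traceAdjointGraph B)
    (hle : ∀ (x y : X) (U : gammaRad H X), (x, U) ∈ G.graph → (U, y) ∈ traceAdjointGraph B →
      (x, y) ∈ A.graph) : G.domain ≤ A.domain := fun x hx =>
  let ⟨y, hy⟩ := hB (G ⟨x, hx⟩)
  LinearPMap.mem_domain_of_mem_graph (hle x y _ (G.mem_graph ⟨x, hx⟩) hy)

theorem apply_mem_traceAdjointGraph_of_comp_le
    (hB : ∀ U : gammaRad H X, ∃ y, (U, y) ∈ traceAdjointGraph B)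
    (hle : ∀ (x y : X) (U : gammaRad H X), (x, U) ∈ G.graph → (U, y) ∈ traceAdjointGraph B →
      (x, y) ∈ A.graph) {x : X} (hG : x ∈ G.domain) (hA : x ∈ A.domain) :
    (G ⟨x, hG⟩, A ⟨x, hA⟩) ∈ traceAdjointGraph B := by
  obtain ⟨y, hy⟩ := hB (G ⟨x, hG⟩)
  have hxy := hle x y _ (G.mem_graph ⟨x, hG⟩) hy
  rwa [← A.mem_graph_snd_inj hxy (A.mem_graph ⟨x, hA⟩) rfl]

end Composition

section Pairing

variable {Ω : Set ℂ} {H : Type*} [NormedAddCommGroup H] [InnerProductSpace ℂ H]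
  {f : Ω → H} {g : Ω → StrongDual ℂ H}

theorem exists_norm_sum_coordinates_le [CompleteSpace H] {ι : Type*} {b : ι → H}
    (hb : Orthonormal ℂ b) (hf : MemValued (HInfty Ω) f) (hg : MemDualValued (HInfty Ω) g) :
    ∃ K : ℝ, ∀ (s : Finset ι) (z : Ω), ‖∑ i ∈ s, innerSL ℂ (b i) (f z) * g z (b i)‖ ≤ K := by
  obtain ⟨M, hM⟩ := exists_norm_le_of_forall_dual_bounded fun h' => (hf h').2
  obtain ⟨N, hN⟩ := banach_steinhaus fun h => (hg h).2
  refine ⟨N * M, fun s z => ?_⟩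
  calc ‖∑ i ∈ s, innerSL ℂ (b i) (f z) * g z (b i)‖
      = ‖g z (∑ i ∈ s, inner ℂ (b i) (f z) • b i)‖ := by simp [map_sum]
    _ ≤ N * M := (g z).le_of_opNorm_le_of_le (hN z)
        ((norm_sum_inner_smul_le hb s _).trans (hM z))

theorem pairing_mem_HInfty [CompleteSpace H] (hΩ : IsOpen Ω) (hf : MemValued (HInfty Ω) f)
    (hg : MemDualValued (HInfty Ω) g) : pairing f g ∈ HInfty Ω := by
  obtain ⟨w, b, -⟩ := exists_hilbertBasis ℂ H
  obtain ⟨K, hK⟩ := exists_norm_sum_coordinates_le b.orthonormal hf hg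
  refine HInfty.mem_of_tendsto (l := atTop) (K := K) hΩ
    (s := fun s : Finset w => ∑ i ∈ s, (fun z => innerSL ℂ (b i) (f z)) * fun z => g z (b i))
    (fun s => sum_mem fun i _ => mul_mem (hf _) (hg _)) (fun s z => ?_) fun z => ?_
  · simpa only [Finset.sum_apply, Pi.mul_apply] using hK s z
  · exact (hasSum_inner_mul_apply b (f z) (g z)).congr fun s => by simp

end Pairing

namespace IsUniversalRegulariser

variable {Ω : Set ℂ} {X : Type*} [NormedAddCommGroup X] [NormedSpace ℂ X]
  {C : FunctionalCalculus (HInfty Ω) X} {e : C.E}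

theorem isRegulariser (he : IsUniversalRegulariser C e) {f : Ω → ℂ} (hf : f ∈ HInfty Ω) :
    C.IsRegulariser e f :=
  ⟨he.mul_mem f hf, he.injective⟩

/-- The regularised calculus `f ↦ Φ(e f)`, which is defined on all of `H^∞(Ω)`. -/
def regularised (he : IsUniversalRegulariser C e) : HInfty Ω →ₗ[ℂ] (X →L[ℂ] X) where
  toFun f := C.Φ ⟨(e : Ω → ℂ) * f, he.mul_mem f f.2⟩
  map_add' f g := by
    rw [← map_add]
    exact congrArg C.Φ (Subtype.ext (mul_add _ _ _))
  map_smul' c f := by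
    rw [← map_smul]
    exact congrArg C.Φ (Subtype.ext (mul_smul_comm _ _ _))

theorem hasSum_regularised (he : IsUniversalRegulariser C e) {ι : Type*} {p : ι → HInfty Ω}
    {q : HInfty Ω} {K : ℝ} (hK : ∀ (s : Finset ι) z, ‖∑ i ∈ s, (p i).1 z‖ ≤ K)
    (hpq : ∀ z, HasSum (fun i => (p i).1 z) (q.1 z)) (x : X) (x' : StrongDual ℂ X) :
    HasSum (fun i => x' (he.regularised (p i) x)) (x' (he.regularised q x)) := by
  -- Weak convergence is assumed along sequences only, but at most countably many `p i` are nonzero.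
  let I : Set ι := {i | (p i).1 ≠ 0}
  have : Countable I := countable_setOf_ne_zero_of_summable
    (fun i => HInfty.continuous (p i).2) fun z => (hpq z).summable
  have hsupp : (Function.support fun i => x' (he.regularised (p i) x)) ⊆ I := fun i hi h0 =>
    hi (by simp [show p i = 0 from Subtype.ext h0])
  refine (hasSum_subtype_iff_of_support_subset hsupp).1 (tendsto_of_seq_tendsto fun s hs => ?_)
  have hpI : ∀ z, HasSum (fun i : I => (p i).1 z) (q.1 z) := fun z => by
    have hsuppz : (Function.support fun i => (p i).1 z) ⊆ I := fun i hi h0 => hi (congrFun h0 z)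
    exact (hasSum_subtype_iff_of_support_subset hsuppz).2 (hpq z)
  have hsum : ∀ n z, (∑ i ∈ s n, p i : HInfty Ω).1 z = ∑ i ∈ s n, (p i).1 z := fun n z => by
    simp
  have hweak := he.weak_conv (fun n => (∑ i ∈ s n, p i : HInfty Ω).1) q.1 (fun n => Subtype.prop _)
    q.2 ⟨K, fun n z => ?_⟩ (fun z => ?_) x x'
  · refine hweak.congr fun n => ?_
    change x' (he.regularised (∑ i ∈ s n, p i) x) = _
    simp [map_sum]
  · simpa only [hsum, Finset.sum_map, Function.Embedding.subtype_apply] using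
      hK ((s n).map (Function.Embedding.subtype _)) z
  · simpa only [hsum, Function.comp_def] using (hpI z).comp hs

end IsUniversalRegulariser

section SquareFunctions

variable {Ω : Set ℂ} {X : Type*} [NormedAddCommGroup X] [NormedSpace ℂ X]
  {H : Type*} [NormedAddCommGroup H] [InnerProductSpace ℂ H] [CompleteSpace H]
  {C : FunctionalCalculus (HInfty Ω) X} {f : Ω → H} {g : Ω → StrongDual ℂ H} {e : C.E}

theorem mem_graph_Phi_pairing (he : IsUniversalRegulariser C e) (hΩ : IsOpen Ω)
    (hf : MemValued (HInfty Ω) f) (hg : MemDualValued (HInfty Ω) g) (hfd : C.DualWellDefined f)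
    (htop : (C.PhiGammaDual f).domain = ⊤) {x y : X} {U : gammaRad H X}
    (hU : (x, U) ∈ (C.PhiGamma g).graph)
    (hy : (U, y) ∈ traceAdjointGraph (C.PhiGammaDual f)) :
    (x, y) ∈ (C.Phi (pairing f g)).graph := by
  have hfg := pairing_mem_HInfty hΩ hf hg
  obtain ⟨w, b, -⟩ := exists_hilbertBasis ℂ H
  obtain ⟨K, hK⟩ := exists_norm_sum_coordinates_le b.orthonormal hf hg
  let p : w → HInfty Ω := fun i =>
    ⟨(fun z => innerSL ℂ (b i) (f z)) * fun z => g z (b i), mul_mem (hf _) (hg _)⟩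
  rw [C.mem_graph_Phi_iff (he.isRegulariser hfg)]
  refine (SeparatingDual.eq_iff_forall_dual_eq (R := ℂ)).2 fun x' => ?_
  let y' : (C.PhiGammaDual f).domain := ⟨x'.comp (C.Φ e), htop ▸ Submodule.mem_top⟩
  have hterm : ∀ i, (C.PhiGammaDual f y').1 (innerSL ℂ (b i)) (U.1 (b i)) =
      x' (he.regularised (p i) x) := fun i => by
    have hfi := he.isRegulariser (hf (innerSL ℂ (b i)))
    rw [FunctionalCalculus.PhiGammaDual_apply_of_eq_comp hfd hfi rfl]
    exact congrArg x' (FunctionalCalculus.apply_mul_of_mem_graph_Phi hfi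
      (he.isRegulariser (hg (b i))) _ (FunctionalCalculus.mem_graph_PhiGamma.1 hU (b i)))
  have hleft : HasSum (fun i => x' (he.regularised (p i) x)) (x' (C.Φ e y)) :=
    (hy y' w b).congr_fun fun i => (hterm i).symm
  have hright : HasSum (fun i => x' (he.regularised (p i) x))
      (x' (he.regularised ⟨pairing f g, hfg⟩ x)) :=
    he.hasSum_regularised hK (fun z => hasSum_inner_mul_apply b (f z) (g z)) x x'
  exact hleft.unique hright

theorem exists_mem_traceAdjointGraph_PhiGammaDual [CompleteSpace X]
    (he : IsUniversalRegulariser C e) (hf : MemValued (HInfty Ω) f) (hfd : C.DualWellDefined f)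
    {K : ℝ≥0} (hK : C.PhiGammaDualBound f K) (U : gammaRad H X) :
    ∃ y, (U, y) ∈ traceAdjointGraph (C.PhiGammaDual f) := by
  refine exists_mem_traceAdjointGraph hK.1 hK.2 (fun h' x => ?_) U
  have hdom := FunctionalCalculus.domain_Phi_eq_top hfd hK.1 h' (he.isRegulariser (hf h'))
  lift x to (C.Phi fun z => h' (f z)).domain using hdom ▸ Submodule.mem_top
  exact ⟨C.Phi _ x, fun x' => (FunctionalCalculus.PhiGammaDual_apply_Phi hfd x' h' x).symm⟩

end SquareFunctions

end SquareFn

theorem mainTheorem4 {Ω : Set ℂ} (hΩ : IsOpen Ω)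
    {X : Type*} [NormedAddCommGroup X] [NormedSpace ℂ X] [CompleteSpace X]
    {H : Type*} [NormedAddCommGroup H] [InnerProductSpace ℂ H] [CompleteSpace H]
    (C : SquareFn.FunctionalCalculus (SquareFn.HInfty Ω) X)
    (hC : ∃ e : C.E, SquareFn.IsUniversalRegulariser C e)
    (f : Ω → H) (hf : SquareFn.MemValued (SquareFn.HInfty Ω) f)
    (g : Ω → StrongDual ℂ H) (hg : SquareFn.MemDualValued (SquareFn.HInfty Ω) g)
    (hfd : C.DualWellDefined f)
    (hfb : ∃ K : NNReal, C.PhiGammaDualBound f K) :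
    -- the inclusion of operators `Φ_γ'(f)' Φ_γ(g) ⊆ Φ(⟨f, g⟩)`
    (∀ (x y : X) (U : SquareFn.gammaRad H X), (x, U) ∈ (C.PhiGamma g).graph →
      (U, y) ∈ SquareFn.traceAdjointGraph (C.PhiGammaDual f) →
      (x, y) ∈ (C.Phi (SquareFn.pairing f g)).graph) ∧
    -- the inclusion of the domains, the duality formula and the lower estimate
    (∃ hdom : (C.PhiGamma g).domain ≤ (C.Phi (SquareFn.pairing f g)).domain,
      (∀ (x : (C.PhiGamma g).domain) (x' : (C.PhiGammaDual f).domain),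
        SquareFn.HasTraceDuality (C.PhiGamma g x) (C.PhiGammaDual f x')
          (x'.1 (C.Phi (SquareFn.pairing f g) ⟨x.1, hdom x.2⟩))) ∧
      (∀ K : NNReal, C.PhiGammaDualBound f K → ∀ x : (C.PhiGamma g).domain,
        ‖C.Phi (SquareFn.pairing f g) ⟨x.1, hdom x.2⟩‖ₑ
          ≤ K * SquareFn.gammaNorm (C.PhiGamma g x).1)) ∧
    -- the case that `Φ_γ(g)` is bounded, too
    ((∃ K : NNReal, C.PhiGammaBound g K) →
      ((C.Phi (SquareFn.pairing f g)).domain = ⊤ ∧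
        ∃ K : NNReal, ∀ x : (C.Phi (SquareFn.pairing f g)).domain,
          ‖C.Phi (SquareFn.pairing f g) x‖ ≤ K * ‖(x : X)‖) ∧
      (∀ (x : X) (hx : x ∈ (C.Phi (SquareFn.pairing f g)).domain)
        (hx' : x ∈ (C.PhiGamma g).domain) (x' : (C.PhiGammaDual f).domain),
        SquareFn.HasTraceDuality (C.PhiGamma g ⟨x, hx'⟩) (C.PhiGammaDual f x')
          (x'.1 (C.Phi (SquareFn.pairing f g) ⟨x, hx⟩))) ∧
      (SquareFn.pairing f g = 1 → ∃ c K : NNReal, 0 < c ∧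
        ∀ x : (C.PhiGamma g).domain,
          c * ‖(x : X)‖ₑ ≤ SquareFn.gammaNorm (C.PhiGamma g x).1 ∧
          SquareFn.gammaNorm (C.PhiGamma g x).1 ≤ K * ‖(x : X)‖ₑ)) := by
  obtain ⟨e, he⟩ := hC
  obtain ⟨K₀, hK₀⟩ := hfb
  have hincl := fun (x y : X) (U : SquareFn.gammaRad H X) =>
    SquareFn.mem_graph_Phi_pairing (x := x) (y := y) (U := U) he hΩ hf hg hfd hK₀.1
  have hadj := SquareFn.exists_mem_traceAdjointGraph_PhiGammaDual he hf hfd hK₀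
  have hdom := SquareFn.domain_le_of_traceAdjointGraph_comp_le hadj hincl
  have hdual : ∀ (x : (C.PhiGamma g).domain) (hx : x.1 ∈ (C.Phi (SquareFn.pairing f g)).domain),
      (C.PhiGamma g x, C.Phi _ ⟨x.1, hx⟩) ∈ SquareFn.traceAdjointGraph (C.PhiGammaDual f) :=
    fun x hx => SquareFn.apply_mem_traceAdjointGraph_of_comp_le hadj hincl x.2 hx
  have hest : ∀ K : ℝ≥0, C.PhiGammaDualBound f K → ∀ x : (C.PhiGamma g).domain,
      ‖C.Phi (SquareFn.pairing f g) ⟨x.1, hdom x.2⟩‖ₑ ≤ K * SquareFn.gammaNorm (C.PhiGamma g x).1 :=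
    fun K hK x => SquareFn.enorm_le_of_mem_traceAdjointGraph hK.1 hK.2 (hdual x (hdom x.2))
  refine ⟨hincl, ⟨hdom, fun x => hdual x (hdom x.2), hest⟩, ?_⟩
  rintro ⟨L, hLtop, hL⟩
  refine ⟨⟨top_le_iff.1 (hLtop ▸ hdom), K₀ * L, fun x => ?_⟩,
    fun x hx hx' => hdual ⟨x, hx'⟩ hx, fun hone => ?_⟩
  · exact SquareFn.norm_le_of_enorm_le_mul_of_le
      (hest K₀ hK₀ ⟨x, hLtop ▸ Submodule.mem_top⟩) (hL _)
  · refine ⟨(K₀ + 1)⁻¹, L, by positivity, fun x => ⟨?_, hL x⟩⟩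
    have hreg := he.isRegulariser (SquareFn.pairing_mem_HInfty hΩ hf hg)
    simpa only [SquareFn.FunctionalCalculus.Phi_apply_of_eq_one hone hreg] using
      SquareFn.inv_add_one_mul_le (hest K₀ hK₀ x)
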